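/- Let $(\mathfrak g,\bullet)$ be a real left symmetric algebra, i.e. $\mathrm{ass}(u,v,w)=\mathrm{ass}(v,u,w)$ where $\mathrm{ass}(u,v,w)=(u\bullet v)\bullet w-u\bullet(v\bullet w)$, with Lie bracket $[u,v]=u\bullet v-v\bullet u$. Let $G$ be a finite-dimensional real Lie group whose Lie algebra is $(\mathfrak g,[\,,])$ (bracket of left invariant vector fields). For $u\in\mathfrak g$ let $u^-$ be the associated right invariant vector field, let $\nabla$ be the right invariant connection on $G$ given by $\nabla_{u^-}v^-=-(u\bullet v)^-$, let $r\in\mathfrak g\otimes\mathfrak g$ be symmetric, and let $r^-$ be the associated right invariant symmetric bivector field on $G$. Let $r_\#:\mathfrak g^*\to\mathfrak g$ be given by $\langle\beta,r_\#(\alpha)\rangle=r(\alpha,\beta)$, and put $$\langle \mathrm L_u^*\alpha,v\rangle=-\langle\alpha,u\bullet v\rangle,\qquad [\alpha,\beta]_r=\mathrm L^*_{r_\#(\alpha)}\beta-\mathrm L^*_{r_\#(\beta)}\alpha .$$ Call $(M,\nabla,h)$ a contravariant pseudo-Hessian manifold if $\nabla$ is a flat (torsion-free, with zero curvature) connection on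 $TM$ and $h$ is a smooth symmetric bivector field such that $(\nabla_{h_\#(\alpha)}h)(\beta,\gamma)=(\nabla_{h_\#(\beta)}h)(\alpha,\gamma)$ for all $\alpha,\beta,\gamma\in\Omega^1(M)$, where $\beta(h_\#(\alpha))=h(\alpha,\beta)$. Then $(G,\nabla,r^-)$ is a contravariant pseudo-Hessian manifold if and only if, for all $\alpha,\beta,\gamma\in\mathfrak g^*$, $$[[r,r]](\alpha,\beta,\gamma):=\langle\gamma,\ r_\#([\alpha,\beta]_r)-[r_\#(\alpha),r_\#(\beta)]\rangle=0 .$$ In this case the product $\alpha.\beta=\mathrm L^*_{r_\#(\alpha)}\beta$ on $\mathfrak g^*$ is left symmetric, $[\,,]_r$ is a Lie bracket on $\mathfrak g^*$, and $r_\#$ is a morphism of Lie algebras from $(\mathfrak g^*,[\,,]_r)$ to $(\mathfrak g,[\,,])$. -/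

import Mathlib

open scoped Manifold ContDiff TensorProduct
open Bundle

noncomputable section

/-! ### Contravariant pseudo-Hessian manifolds -/

section AffineManifolds

variable {E : Type*} [NormedAddCommGroup E] [NormedSpace ℝ E]
  {M : Type*} [TopologicalSpace M] [ChartedSpace E M]

/-- Smooth vector fields on `M`. -/
def IsSmoothVectorField [IsManifold 𝓘(ℝ, E) ∞ M] (X : Π x : M, TangentSpace 𝓘(ℝ, E) x) : Prop :=
  ContMDiff 𝓘(ℝ, E) (𝓘(ℝ, E).prod 𝓘(ℝ, E)) ∞
    (fun x : M ↦ TotalSpace.mk' E (E := fun x : M ↦ TangentSpace 𝓘(ℝ, E) x) x (X x))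

/-- Smooth differential 1-forms on `M`, i.e. smooth sections of the cotangent bundle. -/
structure OneForm (E : Type*) [NormedAddCommGroup E] [NormedSpace ℝ E]
    (M : Type*) [TopologicalSpace M] [ChartedSpace E M] [IsManifold 𝓘(ℝ, E) ∞ M] where
  toFun : Π x : M, TangentSpace 𝓘(ℝ, E) x →L[ℝ] ℝ
  smooth : ContMDiff 𝓘(ℝ, E) (𝓘(ℝ, E).prod 𝓘(ℝ, E →L[ℝ] ℝ)) ∞
    (fun x : M ↦ TotalSpace.mk' (E →L[ℝ] ℝ)
      (E := fun x : M ↦ TangentSpace 𝓘(ℝ, E) x →L[ℝ] ℝ) x (toFun x))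

instance [IsManifold 𝓘(ℝ, E) ∞ M] :
    CoeFun (OneForm E M) (fun _ ↦ Π x : M, TangentSpace 𝓘(ℝ, E) x →L[ℝ] ℝ) :=
  ⟨OneForm.toFun⟩

/-- A (not necessarily smooth) contravariant 2-tensor field on `M`: at each point, a bilinear form
on the cotangent space. -/
abbrev BivectorField (E : Type*) [NormedAddCommGroup E] [NormedSpace ℝ E]
    (M : Type*) [TopologicalSpace M] [ChartedSpace E M] : Type _ :=
  Π x : M, (TangentSpace 𝓘(ℝ, E) x →L[ℝ] ℝ) →L[ℝ] (TangentSpace 𝓘(ℝ, E) x →L[ℝ] ℝ) →L[ℝ] ℝ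

/-- A contravariant 2-tensor field is smooth if its value on any two smooth 1-forms is a smooth
function. -/
def BivectorField.IsSmooth [IsManifold 𝓘(ℝ, E) ∞ M] (h : BivectorField E M) : Prop :=
  ∀ α β : OneForm E M, ContMDiff 𝓘(ℝ, E) 𝓘(ℝ, ℝ) ∞ (fun x : M ↦ h x (α x) (β x))

instance tangentSpace_finiteDimensional [FiniteDimensional ℝ E] (x : M) :
    FiniteDimensional ℝ (TangentSpace 𝓘(ℝ, E) x) :=
  inferInstanceAs (FiniteDimensional ℝ E)

instance tangentSpace_t2Space (x : M) : T2Space (TangentSpace 𝓘(ℝ, E) x) :=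
  inferInstanceAs (T2Space E)

/-- The contraction `h_# : T*M → TM` at `x`, determined by `β (h_# α) = h (α, β)`. -/
def BivectorField.sharp [FiniteDimensional ℝ E] (h : BivectorField E M) (x : M)
    (α : TangentSpace 𝓘(ℝ, E) x →L[ℝ] ℝ) : TangentSpace 𝓘(ℝ, E) x :=
  (Module.evalEquiv ℝ (TangentSpace 𝓘(ℝ, E) x)).symm
    ((h x α).toLinearMap ∘ₗ
      (LinearMap.toContinuousLinearMap :
        (TangentSpace 𝓘(ℝ, E) x →ₗ[ℝ] ℝ) ≃ₗ[ℝ] (TangentSpace 𝓘(ℝ, E) x →L[ℝ] ℝ)).toLinearMap)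

theorem BivectorField.apply_sharp [FiniteDimensional ℝ E] (h : BivectorField E M) (x : M)
    (α β : TangentSpace 𝓘(ℝ, E) x →L[ℝ] ℝ) : β (h.sharp x α) = h x α β := by
  have := Module.apply_evalEquiv_symm_apply ℝ (TangentSpace 𝓘(ℝ, E) x) β.toLinearMap
    ((h x α).toLinearMap ∘ₗ
      (LinearMap.toContinuousLinearMap :
        (TangentSpace 𝓘(ℝ, E) x →ₗ[ℝ] ℝ) ≃ₗ[ℝ] (TangentSpace 𝓘(ℝ, E) x →L[ℝ] ℝ)).toLinearMap)
  exact this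

variable [IsManifold 𝓘(ℝ, E) ∞ M]
  (D : CovariantDerivative 𝓘(ℝ, E) E (TangentSpace 𝓘(ℝ, E) : M → Type _))

namespace CovariantDerivative

/-- A connection on `TM` is flat if it is smooth (`∇_X Y` is smooth for smooth `X`, `Y`), it is torsionless and its curvature
`∇_X ∇_Y Z - ∇_Y ∇_X Z - ∇_[X,Y] Z` vanishes. A manifold with such a connection is an affine
manifold. Note that `D Y x (X x)` is `(∇_X Y)(x)`. -/
structure IsFlat : Prop where
  smooth : ∀ X Y : Π x : M, TangentSpace 𝓘(ℝ, E) x,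
    IsSmoothVectorField X → IsSmoothVectorField Y → IsSmoothVectorField fun x ↦ D Y x (X x)
  torsion_eq_zero : ∀ X Y : Π x : M, TangentSpace 𝓘(ℝ, E) x,
    IsSmoothVectorField X → IsSmoothVectorField Y → ∀ x,
      D Y x (X x) - D X x (Y x) = VectorField.mlieBracket 𝓘(ℝ, E) X Y x
  curvature_eq_zero : ∀ X Y Z : Π x : M, TangentSpace 𝓘(ℝ, E) x,
    IsSmoothVectorField X → IsSmoothVectorField Y → IsSmoothVectorField Z → ∀ x,
      D (fun y ↦ D Z y (Y y)) x (X x) - D (fun y ↦ D Z y (X y)) x (Y x)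
        - D Z x (VectorField.mlieBracket 𝓘(ℝ, E) X Y x) = 0

/-- The expression `X(β(Y)) - β(∇_X Y)` at `x`, for a tangent vector `X` at `x`. -/
def dualAux (β : Π x : M, TangentSpace 𝓘(ℝ, E) x →L[ℝ] ℝ) (x : M) (X : TangentSpace 𝓘(ℝ, E) x)
    (Y : Π x : M, TangentSpace 𝓘(ℝ, E) x) : ℝ :=
  mvfderiv 𝓘(ℝ, E) (fun y ↦ β y (Y y)) x X - β x (D Y x X)

theorem _root_.OneForm.mdifferentiableAt_apply (β : OneForm E M) {x : M}
    {Y : Π x : M, TangentSpace 𝓘(ℝ, E) x} (hY : MDiffAt (T% Y) x) :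
    MDiffAt (fun y ↦ β y (Y y)) x := by
  have h1 := (β.smooth.mdifferentiable (by simp)) x
  have := MDifferentiableAt.clm_bundle_apply (F₁ := E) (F₂ := ℝ)
    (E₁ := fun x : M ↦ TangentSpace 𝓘(ℝ, E) x) (E₂ := Bundle.Trivial M ℝ)
    (b := fun x ↦ x) (ϕ := fun x ↦ β x) (v := Y) h1 hY
  rw [mdifferentiableAt_totalSpace] at this
  exact this.2

theorem tensorialAt_dualAux (β : OneForm E M) (x : M) (X : TangentSpace 𝓘(ℝ, E) x) :
    TensorialAt 𝓘(ℝ, E) E (D.dualAux β x X) x where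
  smul {f Y} hf hY := by
    have h1 := β.mdifferentiableAt_apply hY
    have h2 := D.isCovariantDerivativeOnUniv.leibniz hY hf
    have h3 : (fun y ↦ β y ((f • Y) y)) = fun y ↦ f y * β y (Y y) := by
      ext y; simp
    simp only [dualAux, h2, h3, mvfderiv_fun_mul hf h1]
    simp
    ring
  add {Y Z} hY hZ := by
    have h2 := D.isCovariantDerivativeOnUniv.add hY hZ
    have h3 : (fun y ↦ β y ((Y + Z) y)) = fun y ↦ β y (Y y) + β y (Z y) := by
      ext y; simp
    simp only [dualAux, h2, h3,
      mvfderiv_fun_add (β.mdifferentiableAt_apply hY) (β.mdifferentiableAt_apply hZ)]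
    simp
    ring

variable [FiniteDimensional ℝ E]

/-- The covariant derivative `∇_X β` at `x` of a 1-form `β` in the direction of a tangent vector
`X` at `x`; it is characterized by `(∇_X β)(Y) = X(β(Y)) - β(∇_X Y)`. -/
def nablaForm (β : OneForm E M) (x : M) (X : TangentSpace 𝓘(ℝ, E) x) :
    TangentSpace 𝓘(ℝ, E) x →L[ℝ] ℝ :=
  TensorialAt.mkHom (D.dualAux β x X) x (D.tensorialAt_dualAux β x X)

theorem nablaForm_apply (β : OneForm E M) {x : M} (X : TangentSpace 𝓘(ℝ, E) x)
    {Y : Π x : M, TangentSpace 𝓘(ℝ, E) x} (hY : MDiffAt (T% Y) x) :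
    D.nablaForm β x X (Y x) = mvfderiv 𝓘(ℝ, E) (fun y ↦ β y (Y y)) x X - β x (D Y x X) :=
  TensorialAt.mkHom_apply (D.tensorialAt_dualAux β x X) hY

/-- `(∇_X h)(β, γ) = X(h(β, γ)) - h(∇_X β, γ) - h(β, ∇_X γ)` at `x`, for a tangent vector `X`
at `x`. -/
def nablaBivector (h : BivectorField E M) (β γ : OneForm E M) (x : M)
    (X : TangentSpace 𝓘(ℝ, E) x) : ℝ :=
  mvfderiv 𝓘(ℝ, E) (fun y ↦ h y (β y) (γ y)) x X
    - h x (D.nablaForm β x X) (γ x) - h x (β x) (D.nablaForm γ x X)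

end CovariantDerivative

/-- `(M, ∇, h)` is a contravariant pseudo-Hessian manifold: `∇` is a flat connection and `h` is a
smooth symmetric bivector field which satisfies the contravariant Codazzi equation
`(∇_{h_# α} h)(β, γ) = (∇_{h_# β} h)(α, γ)`. -/
structure IsContravariantPseudoHessian [FiniteDimensional ℝ E]
    (D : CovariantDerivative 𝓘(ℝ, E) E (TangentSpace 𝓘(ℝ, E) : M → Type _))
    (h : BivectorField E M) : Prop where
  flat : D.IsFlat
  smooth : h.IsSmooth
  symm : ∀ x α β, h x α β = h x β α
  codazzi : ∀ (α β γ : OneForm E M) (x : M),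
    D.nablaBivector h β γ x (h.sharp x (α x)) = D.nablaBivector h α γ x (h.sharp x (β x))

end AffineManifolds

/-! ### Left symmetric algebras and symmetric bivectors -/

section Algebra

/-- The product `m` on `V` is left symmetric: its associator is symmetric in the first two
variables. -/
def IsLeftSymmetricProduct {V : Type*} [AddCommGroup V] [Module ℝ V]
    (m : V →ₗ[ℝ] V →ₗ[ℝ] V) : Prop :=
  ∀ a b c : V, m (m a b) c - m a (m b c) = m (m b a) c - m b (m a c)

/-- The bilinear map `b` on `V` is a Lie bracket. -/
structure IsLieBracket {V : Type*} [AddCommGroup V] [Module ℝ V]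
    (b : V →ₗ[ℝ] V →ₗ[ℝ] V) : Prop where
  self : ∀ x, b x x = 0
  jacobi : ∀ x y z, b x (b y z) + b y (b z x) + b z (b x y) = 0

variable {𝔤 : Type*} [LeftPreLieRing 𝔤] [LeftPreLieAlgebra ℝ 𝔤]

/-- `r ∈ 𝔤 ⊗ 𝔤` as a bilinear form on `𝔤*`: `(u ⊗ v)(α, β) = α u * β v`. -/
def tensorForm (r : 𝔤 ⊗[ℝ] 𝔤) : Module.Dual ℝ 𝔤 →ₗ[ℝ] Module.Dual ℝ 𝔤 →ₗ[ℝ] ℝ :=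
  LinearMap.mk₂ ℝ (fun α β ↦ TensorProduct.dualDistrib ℝ 𝔤 𝔤 (α ⊗ₜ β) r)
    (by simp [TensorProduct.add_tmul]) (by simp [← TensorProduct.smul_tmul'])
    (by simp [TensorProduct.tmul_add]) (by simp)

/-- The contraction `r_# : 𝔤* → 𝔤`, with `(u ⊗ v)_# α = α u • v`. -/
def tensorSharp (r : 𝔤 ⊗[ℝ] 𝔤) : Module.Dual ℝ 𝔤 →ₗ[ℝ] 𝔤 :=
  (TensorProduct.lid ℝ 𝔤).toLinearMap ∘ₗ
    (LinearMap.rTensorHom 𝔤 : Module.Dual ℝ 𝔤 →ₗ[ℝ] (𝔤 ⊗[ℝ] 𝔤 →ₗ[ℝ] ℝ ⊗[ℝ] 𝔤)).flip r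

theorem apply_tensorSharp (r : 𝔤 ⊗[ℝ] 𝔤) (α β : Module.Dual ℝ 𝔤) :
    β (tensorSharp r α) = tensorForm r α β := by
  induction r with
  | zero => simp [tensorSharp, tensorForm]
  | tmul u v => simp [tensorSharp, tensorForm]
  | add r s hr hs =>
    simp only [tensorSharp, tensorForm, LinearMap.mk₂_apply, map_add, LinearMap.comp_apply] at *
    rw [← hr, ← hs]
    simp

/-- `L*_u α`, given by `(L*_u α) v = -α (u * v)`. -/
def dualLeftMul (u : 𝔤) (α : Module.Dual ℝ 𝔤) : Module.Dual ℝ 𝔤 :=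
  -(α ∘ₗ LinearMap.mulLeft ℝ u)

/-- The product `α.β = L*_{r_# α} β` on `𝔤*`. -/
def dualProduct (r : 𝔤 ⊗[ℝ] 𝔤) :
    Module.Dual ℝ 𝔤 →ₗ[ℝ] Module.Dual ℝ 𝔤 →ₗ[ℝ] Module.Dual ℝ 𝔤 :=
  LinearMap.mk₂ ℝ (fun α β ↦ dualLeftMul (tensorSharp r α) β)
    (fun α α' β ↦ by ext v; simp [dualLeftMul, add_mul]; ring)
    (fun c α β ↦ by ext v; simp [dualLeftMul, smul_mul_assoc])
    (fun α β β' ↦ by ext v; simp [dualLeftMul]; ring)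
    (fun c α β ↦ by ext v; simp [dualLeftMul])

/-- The bracket `[α, β]_r = L*_{r_# α} β - L*_{r_# β} α` on `𝔤*`. -/
def dualBracket (r : 𝔤 ⊗[ℝ] 𝔤) :
    Module.Dual ℝ 𝔤 →ₗ[ℝ] Module.Dual ℝ 𝔤 →ₗ[ℝ] Module.Dual ℝ 𝔤 :=
  LinearMap.mk₂ ℝ
    (fun α β ↦ dualLeftMul (tensorSharp r α) β - dualLeftMul (tensorSharp r β) α)
    (fun α α' β ↦ by ext v; simp [dualLeftMul, add_mul]; ring)
    (fun c α β ↦ by ext v; simp [dualLeftMul, smul_mul_assoc])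
    (fun α β β' ↦ by ext v; simp [dualLeftMul, add_mul]; ring)
    (fun c α β ↦ by ext v; simp [dualLeftMul, smul_mul_assoc])

/-- `[[r, r]](α, β, γ) = ⟨γ, r_# [α, β]_r - [r_# α, r_# β]⟩`, where `[u, v] = u * v - v * u`. -/
def sMatrixTensor (r : 𝔤 ⊗[ℝ] 𝔤) (α β γ : Module.Dual ℝ 𝔤) : ℝ :=
  γ (tensorSharp r (dualBracket r α β) - ⁅tensorSharp r α, tensorSharp r β⁆)

end Algebra

/-! ### Right invariant objects on a Lie group -/

section RightInvariant

variable {E : Type*} [NormedAddCommGroup E] [NormedSpace ℝ E]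
  {G : Type*} [TopologicalSpace G] [ChartedSpace E G] [Group G] [LieGroup 𝓘(ℝ, E) ∞ G]

instance lieGroup_minSmoothness : LieGroup 𝓘(ℝ, E) (minSmoothness ℝ 3) G :=
  LieGroup.of_le (n := ∞) (by
    rw [minSmoothness_of_isRCLikeNormedField]
    exact ENat.LEInfty.out)

/-- The differential at `1` of the right translation by `x`. -/
def rightTranslation (x : G) :
    GroupLieAlgebra 𝓘(ℝ, E) G →L[ℝ] TangentSpace 𝓘(ℝ, E) x :=
  (mfderiv 𝓘(ℝ, E) 𝓘(ℝ, E) (fun y : G ↦ y * x) 1 :)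

/-- The differential at `x` of the right translation by `x⁻¹`, with values in the tangent space
at `1`: the right Maurer-Cartan form. -/
def rightMaurerCartan (x : G) :
    TangentSpace 𝓘(ℝ, E) x →L[ℝ] GroupLieAlgebra 𝓘(ℝ, E) G :=
  (mfderiv 𝓘(ℝ, E) 𝓘(ℝ, E) (fun y : G ↦ y * x⁻¹) x :)

/-- A vector field on `G` read in the right trivialization `TG ≅ G × T₁G`. -/
def rightCoord (Y : Π x : G, TangentSpace 𝓘(ℝ, E) x) (x : G) : E :=
  rightMaurerCartan x (Y x)

theorem mdifferentiableAt_rightCoord {Y : Π x : G, TangentSpace 𝓘(ℝ, E) x} {x : G}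
    (hY : MDiffAt (T% Y) x) : MDiffAt (rightCoord Y) x := by
  have h0 : ContMDiff (𝓘(ℝ, E).prod 𝓘(ℝ, E)) 𝓘(ℝ, E) ∞ (fun p : G × G ↦ p.1 * p.2) :=
    contMDiff_mul 𝓘(ℝ, E) ∞
  let F₁ : G → TangentBundle 𝓘(ℝ, E) G × TangentBundle 𝓘(ℝ, E) G :=
    fun y ↦ (⟨y, Y y⟩, ⟨y⁻¹, 0⟩)
  have h1 : MDiffAt F₁ x := by
    refine MDifferentiableAt.prodMk hY ?_
    have a1 : MDiffAt (fun y : G ↦ y⁻¹) x :=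
      (contMDiff_inv 𝓘(ℝ, E) ∞).mdifferentiable (by simp) x
    have a2 := (Bundle.mdifferentiable_zeroSection ℝ
      (fun x : G ↦ TangentSpace 𝓘(ℝ, E) x) (IB := 𝓘(ℝ, E)) (F := E)) x⁻¹
    exact a2.comp x a1
  let F₂ : (TangentBundle 𝓘(ℝ, E) G × TangentBundle 𝓘(ℝ, E) G) →
      TangentBundle (𝓘(ℝ, E).prod 𝓘(ℝ, E)) (G × G) :=
    (equivTangentBundleProd 𝓘(ℝ, E) G 𝓘(ℝ, E) G).symm
  have h2 : ContMDiff _ _ 1 F₂ := contMDiff_equivTangentBundleProd_symm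
  let F₃ : TangentBundle (𝓘(ℝ, E).prod 𝓘(ℝ, E)) (G × G) → TangentBundle 𝓘(ℝ, E) G :=
    tangentMap (𝓘(ℝ, E).prod 𝓘(ℝ, E)) 𝓘(ℝ, E) (fun p : G × G ↦ p.1 * p.2)
  have h3 : ContMDiff _ _ 1 F₃ := h0.contMDiff_tangentMap (m := 1)
    (by rw [one_add_one_eq_two]; exact ENat.LEInfty.out)
  have h4 : MDiffAt (fun y ↦ F₃ (F₂ (F₁ y))) x :=
    ((h3.mdifferentiable (by simp)) _).comp x (((h2.mdifferentiable (by simp)) _).comp x h1)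
  have key : ∀ z : G, z = 1 → ∀ w : E,
      (TotalSpace.mk z w : TangentBundle 𝓘(ℝ, E) G) = TotalSpace.mk 1 w := by
    rintro _ rfl _
    rfl
  let w : G → E := rightCoord Y
  have h5 : (fun y ↦ F₃ (F₂ (F₁ y)))
      = fun y ↦ (TotalSpace.mk 1 (w y) : TangentBundle 𝓘(ℝ, E) G) := by
    ext1 y
    refine Eq.trans ?_ (key (y * y⁻¹) (mul_inv_cancel y) (w y))
    change (TotalSpace.mk (y * y⁻¹) _ : TangentBundle 𝓘(ℝ, E) G) = _
    congr 1
    have := mfderiv_prod_eq_add_apply (v := ((Y y, 0) : E × E))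
      ((h0.mdifferentiable (by simp)) (y, y⁻¹))
    refine this.trans ?_
    simp only [w, rightCoord, rightMaurerCartan]
    erw [map_zero, add_zero]
    rfl
  rw [h5] at h4
  have h6 := ((mdifferentiableAt_totalSpace 𝓘(ℝ, E) _).1 h4).2
  have h7 : ∀ v : E, (trivializationAt E (TangentSpace 𝓘(ℝ, E) : G → Type _) 1
      (TotalSpace.mk 1 v : TangentBundle 𝓘(ℝ, E) G)).2 = v := fun v ↦
    (tangentBundleCore 𝓘(ℝ, E) G).coordChange_self (achart E 1) 1 (mem_chart_source E 1) v
  have h8 : (fun y ↦ (trivializationAt E (TangentSpace 𝓘(ℝ, E) : G → Type _) 1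
      (TotalSpace.mk 1 (w y) : TangentBundle 𝓘(ℝ, E) G)).2) = w := funext fun y ↦ h7 (w y)
  change MDiffAt w x
  rw [← h8]
  exact h6

/-- The derivative of a vector field read in the right trivialization. -/
def rightCoordDeriv (Y : Π x : G, TangentSpace 𝓘(ℝ, E) x) (x : G) :
    TangentSpace 𝓘(ℝ, E) x →L[ℝ] GroupLieAlgebra 𝓘(ℝ, E) G :=
  mvfderiv 𝓘(ℝ, E) (rightCoord Y) x

theorem rightCoordDeriv_add {Y Z : Π x : G, TangentSpace 𝓘(ℝ, E) x} {x : G}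
    (hY : MDiffAt (T% Y) x) (hZ : MDiffAt (T% Z) x) :
    rightCoordDeriv (Y + Z) x = rightCoordDeriv Y x + rightCoordDeriv Z x := by
  have h1 : rightCoord (Y + Z) = fun y ↦ rightCoord Y y + rightCoord Z y := by
    ext y
    exact map_add (rightMaurerCartan y) _ _
  have h2 : mvfderiv 𝓘(ℝ, E) (rightCoord (Y + Z)) x
      = mvfderiv 𝓘(ℝ, E) (rightCoord Y) x + mvfderiv 𝓘(ℝ, E) (rightCoord Z) x := by
    rw [h1, mvfderiv_fun_add (mdifferentiableAt_rightCoord hY) (mdifferentiableAt_rightCoord hZ)]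
  exact h2

theorem rightCoordDeriv_smul {f : G → ℝ} {Y : Π x : G, TangentSpace 𝓘(ℝ, E) x} {x : G}
    (hf : MDiffAt f x) (hY : MDiffAt (T% Y) x) :
    rightCoordDeriv (f • Y) x = f x • rightCoordDeriv Y x
      + (mvfderiv 𝓘(ℝ, E) f x).smulRight (rightMaurerCartan x (Y x)) := by
  have h1 : rightCoord (f • Y) = fun y ↦ f y • rightCoord Y y := by
    ext y
    exact map_smul (rightMaurerCartan y) _ _
  have h2 : mvfderiv 𝓘(ℝ, E) (rightCoord (f • Y)) x
      = f x • mvfderiv 𝓘(ℝ, E) (rightCoord Y) x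
        + (mvfderiv 𝓘(ℝ, E) f x).smulRight (rightCoord Y x) := by
    rw [h1, mvfderiv_fun_smul hf (mdifferentiableAt_rightCoord hY)]
  exact h2

theorem rightTranslation_rightMaurerCartan (x : G) (v : TangentSpace 𝓘(ℝ, E) x) :
    rightTranslation x (rightMaurerCartan x v) = v := by
  have h1 : MDiffAt (fun y : G ↦ y * x⁻¹) x :=
    (contMDiff_mul_right (I := 𝓘(ℝ, E)) (n := ∞)).mdifferentiable (by simp) x
  have h2 : MDiffAt (fun y : G ↦ y * x) (x * x⁻¹) :=
    (contMDiff_mul_right (I := 𝓘(ℝ, E)) (n := ∞)).mdifferentiable (by simp) _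
  have h3 := mfderiv_comp x h2 h1
  have h4 : ((fun y : G ↦ y * x) ∘ fun y : G ↦ y * x⁻¹) = id := by ext y; simp
  rw [h4, mfderiv_id] at h3
  have key : ∀ z : G, z = 1 → ∀ w : E,
      ((mfderiv 𝓘(ℝ, E) 𝓘(ℝ, E) (fun y : G ↦ y * x) z : E →L[ℝ] E) w : E)
        = (mfderiv 𝓘(ℝ, E) 𝓘(ℝ, E) (fun y : G ↦ y * x) 1 : E →L[ℝ] E) w := by
    rintro _ rfl _
    rfl
  exact ((congrArg (fun L ↦ (L v : E)) h3).trans (key _ (mul_inv_cancel x) _)).symm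

theorem rightMaurerCartan_rightTranslation (x : G) (v : GroupLieAlgebra 𝓘(ℝ, E) G) :
    rightMaurerCartan x (rightTranslation x v) = v := by
  have h1 : MDiffAt (fun y : G ↦ y * x) 1 :=
    (contMDiff_mul_right (I := 𝓘(ℝ, E)) (n := ∞)).mdifferentiable (by simp) 1
  have h2 : MDiffAt (fun y : G ↦ y * x⁻¹) (1 * x) :=
    (contMDiff_mul_right (I := 𝓘(ℝ, E)) (n := ∞)).mdifferentiable (by simp) _
  have h3 := mfderiv_comp 1 h2 h1
  have h4 : ((fun y : G ↦ y * x⁻¹) ∘ fun y : G ↦ y * x) = id := by ext y; simp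
  rw [h4, mfderiv_id] at h3
  have key : ∀ z : G, z = x → ∀ w : E,
      ((mfderiv 𝓘(ℝ, E) 𝓘(ℝ, E) (fun y : G ↦ y * x⁻¹) z : E →L[ℝ] E) w : E)
        = (mfderiv 𝓘(ℝ, E) 𝓘(ℝ, E) (fun y : G ↦ y * x⁻¹) x : E →L[ℝ] E) w := by
    rintro _ rfl _
    rfl
  exact ((congrArg (fun L ↦ (L v : E)) h3).trans (key _ (one_mul x) _)).symm

variable [FiniteDimensional ℝ E] {𝔤 : Type*} [LeftPreLieRing 𝔤] [LeftPreLieAlgebra ℝ 𝔤]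

/-- The right invariant vector field `u⁻` associated with `u`. -/
def rightInvariantField (φ : 𝔤 ≃ₗ⁅ℝ⁆ GroupLieAlgebra 𝓘(ℝ, E) G) (u : 𝔤) (x : G) :
    TangentSpace 𝓘(ℝ, E) x :=
  rightTranslation x (φ u)

/-- The product of `𝔤` in the first variable, transported to the Lie algebra of `G`:
`v ↦ φ (φ⁻¹ v * φ⁻¹ w)`. -/
def transportedMul (φ : 𝔤 ≃ₗ⁅ℝ⁆ GroupLieAlgebra 𝓘(ℝ, E) G) (w : GroupLieAlgebra 𝓘(ℝ, E) G) :
    GroupLieAlgebra 𝓘(ℝ, E) G →L[ℝ] GroupLieAlgebra 𝓘(ℝ, E) G :=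
  LinearMap.toContinuousLinearMap
    { toFun := fun v ↦ φ (φ.symm v * φ.symm w)
      map_add' := fun v v' ↦ by simp [add_mul]
      map_smul' := fun c v ↦ by simp [smul_mul_assoc] }

/-- The right invariant connection on `G` with `∇_{u⁻} v⁻ = -(u * v)⁻`: reading `Y` in the
right trivialization as a function `Ŷ : G → T₁G`, and writing `ω` for the right Maurer-Cartan form,
`∇_X Y` corresponds to `dŶ(X) - ω(X) * Ŷ`. -/
def rightInvariantConnection (φ : 𝔤 ≃ₗ⁅ℝ⁆ GroupLieAlgebra 𝓘(ℝ, E) G) :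
    CovariantDerivative 𝓘(ℝ, E) E (TangentSpace 𝓘(ℝ, E) : G → Type _) where
  toFun := fun Y x ↦ rightTranslation x ∘L
    (rightCoordDeriv Y x - transportedMul φ (rightMaurerCartan x (Y x)) ∘L rightMaurerCartan x)
  isCovariantDerivativeOnUniv :=
    { add := by
        intro Y Z x hY hZ _
        ext X
        simp [rightCoordDeriv_add hY hZ, transportedMul, mul_add]
        abel
      leibniz := by
        intro Y f x hY hf _
        ext X
        simp [rightCoordDeriv_smul hf hY, transportedMul, rightTranslation_rightMaurerCartan,
          smul_sub, mul_smul_comm]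
        abel }

theorem rightInvariantConnection_rightInvariantField
    (φ : 𝔤 ≃ₗ⁅ℝ⁆ GroupLieAlgebra 𝓘(ℝ, E) G) (u v : 𝔤) (x : G) :
    rightInvariantConnection φ (rightInvariantField φ v) x (rightInvariantField φ u x)
      = -rightInvariantField φ (u * v) x := by
  have h1 : rightCoord (rightInvariantField φ v) = fun _ ↦ (φ v : E) := by
    ext y
    exact rightMaurerCartan_rightTranslation y (φ v)
  have h2 : rightCoordDeriv (rightInvariantField φ v) x = 0 := by
    unfold rightCoordDeriv
    rw [h1]
    exact mvfderiv_const ..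
  simp [rightInvariantConnection, h2, transportedMul, rightInvariantField,
    rightMaurerCartan_rightTranslation]

/-- The right invariant bivector field `r⁻` associated with `r ∈ 𝔤 ⊗ 𝔤`: its value at `x` is the
image of `r` under the differential of the right translation by `x`. -/
def rightInvariantBivector (φ : 𝔤 ≃ₗ⁅ℝ⁆ GroupLieAlgebra 𝓘(ℝ, E) G) (r : 𝔤 ⊗[ℝ] 𝔤) :
    BivectorField E G := fun x ↦
  let pull : (TangentSpace 𝓘(ℝ, E) x →L[ℝ] ℝ) →ₗ[ℝ] Module.Dual ℝ 𝔤 :=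
    { toFun := fun α ↦
        α.toLinearMap ∘ₗ (rightTranslation x).toLinearMap ∘ₗ (φ : 𝔤 →ₗ[ℝ] _)
      map_add' := fun _ _ ↦ rfl
      map_smul' := fun _ _ ↦ rfl }
  LinearMap.toContinuousBilinearMap ((tensorForm r).compl₁₂ pull pull)

theorem rightInvariantBivector_apply (φ : 𝔤 ≃ₗ⁅ℝ⁆ GroupLieAlgebra 𝓘(ℝ, E) G) (u v : 𝔤) (x : G)
    (α β : TangentSpace 𝓘(ℝ, E) x →L[ℝ] ℝ) :
    rightInvariantBivector φ (u ⊗ₜ v) x α β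
      = α (rightInvariantField φ u x) * β (rightInvariantField φ v x) := by
  simp [rightInvariantBivector, tensorForm, rightInvariantField]

end RightInvariant
end

/-! Right translation trivializes `TG` as `G × T₁G`, so a vector field `Y` becomes a function `Ŷ`
into a fixed vector space and `∇_X Y` becomes `X(Ŷ) - X̂ • Ŷ`. Flatness is then algebra. The torsion
vanishes because brackets of right invariant fields satisfy `[u⁻, v⁻] = -[u, v]⁻`
(`mlieBracket_rightField`). In the curvature the second derivatives cancel, since `[X, Y]` acts on
functions as a commutator (`mvfderiv_mvfderiv_sub`), and what remains is, up to sign, `ass(X̂, Ŷ, Ẑ)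
- ass(Ŷ, X̂, Ẑ)`.

For the Codazzi equation, pull covectors at `x` back to `𝔤*`. The derivatives of the 1-forms cancel
in `∇_{u⁻} r⁻`, leaving `r(L*_u β, γ) + r(β, L*_u γ)` (`nablaBivector_rightInvariantBivector`). With
`u = r_# α` this, antisymmetrized in `α` and `β`, is exactly `[[r, r]](α, β, γ)`
(`sMatrixTensor_eq`). Right invariant 1-forms realize every triple in `𝔤*`, which gives the
equivalence.

Finally `[[r, r]] = 0` says that `r_#` carries `[,]_r` to `[,]`. Left symmetry of `•` makes `L*` a
representation of the Lie algebra, so the product on `𝔤*` is left symmetric, and its commutator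
`[,]_r` satisfies Jacobi. -/

noncomputable section

/-! ### Smoothness in the right trivialization of `TG`. -/

section RightTrivialization

variable {E : Type*} [NormedAddCommGroup E] [NormedSpace ℝ E]
  {G : Type*} [TopologicalSpace G] [ChartedSpace E G] [Group G]

/-- The vector field on `G` which the right trivialization identifies with `w : G → T₁G`. -/
def rightField (w : G → E) (x : G) : TangentSpace 𝓘(ℝ, E) x :=
  rightTranslation x (w x)

theorem rightField_congr {w₁ w₂ : G → E} {x : G} (h : w₁ x = w₂ x) :
    rightField w₁ x = rightField w₂ x :=
  congrArg (fun v : E ↦ (rightTranslation x : E →L[ℝ] TangentSpace 𝓘(ℝ, E) x) v) h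

theorem rightField_sub_apply (w₁ w₂ : G → E) (x : G) :
    rightField (fun y ↦ w₁ y - w₂ y) x = rightField w₁ x - rightField w₂ x :=
  map_sub (rightTranslation x : E →L[ℝ] TangentSpace 𝓘(ℝ, E) x) (w₁ x) (w₂ x)

theorem rightField_zero_apply (x : G) : rightField (fun _ : G ↦ (0 : E)) x = 0 :=
  map_zero (rightTranslation x : E →L[ℝ] TangentSpace 𝓘(ℝ, E) x)

theorem rightCoord_sub_apply (X Y : Π x : G, TangentSpace 𝓘(ℝ, E) x) (x : G) :
    rightCoord (fun y ↦ X y - Y y) x = rightCoord X x - rightCoord Y x :=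
  map_sub (rightMaurerCartan x : TangentSpace 𝓘(ℝ, E) x →L[ℝ] E) (X x) (Y x)

variable [LieGroup 𝓘(ℝ, E) ∞ G]

/-- A differential of right translation depends on its base point, so its joint smoothness is not
immediate. It is the differential of multiplication with a zero vector in the second slot, and that
map is smooth on `TG × TG`. -/
theorem contMDiff_tangentMap_mul :
    ContMDiff ((𝓘(ℝ, E).prod 𝓘(ℝ, E)).prod (𝓘(ℝ, E).prod 𝓘(ℝ, E))) (𝓘(ℝ, E).prod 𝓘(ℝ, E)) ∞
      (fun p : TangentBundle 𝓘(ℝ, E) G × TangentBundle 𝓘(ℝ, E) G ↦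
        tangentMap (𝓘(ℝ, E).prod 𝓘(ℝ, E)) 𝓘(ℝ, E) (fun q : G × G ↦ q.1 * q.2)
          ((equivTangentBundleProd 𝓘(ℝ, E) G 𝓘(ℝ, E) G).symm p)) :=
  ((contMDiff_mul 𝓘(ℝ, E) ∞).contMDiff_tangentMap (m := ∞) le_rfl).comp
    contMDiff_equivTangentBundleProd_symm

theorem tangentMap_mul_zero_right (y z : G) (v : TangentSpace 𝓘(ℝ, E) y) :
    tangentMap (𝓘(ℝ, E).prod 𝓘(ℝ, E)) 𝓘(ℝ, E) (fun q : G × G ↦ q.1 * q.2)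
        ((equivTangentBundleProd 𝓘(ℝ, E) G 𝓘(ℝ, E) G).symm
          ((⟨y, v⟩, ⟨z, 0⟩) : TangentBundle 𝓘(ℝ, E) G × TangentBundle 𝓘(ℝ, E) G))
      = ⟨y * z, mfderiv 𝓘(ℝ, E) 𝓘(ℝ, E) (fun q : G ↦ q * z) y v⟩ := by
  change (TotalSpace.mk (y * z) _ : TangentBundle 𝓘(ℝ, E) G) = _
  congr 1
  have := mfderiv_prod_eq_add_apply (v := ((v, 0) : E × E))
    ((contMDiff_mul 𝓘(ℝ, E) (G := G) ∞).mdifferentiable (by simp) (y, z))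
  refine this.trans ?_
  erw [map_zero, add_zero]

/-- A curve of tangent vectors at a fixed point is smooth if and only if it is smooth as a curve in
the model space. -/
theorem contMDiff_mk_one_iff {w : G → E} :
    ContMDiff 𝓘(ℝ, E) (𝓘(ℝ, E).prod 𝓘(ℝ, E)) ∞
      (fun y : G ↦ (TotalSpace.mk 1 (w y) : TangentBundle 𝓘(ℝ, E) G)) ↔
    ContMDiff 𝓘(ℝ, E) 𝓘(ℝ, E) ∞ w := by
  have h1 : ∀ v : E, (trivializationAt E (TangentSpace 𝓘(ℝ, E) : G → Type _) 1
      (TotalSpace.mk 1 v : TangentBundle 𝓘(ℝ, E) G)).2 = v := fun v ↦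
    (tangentBundleCore 𝓘(ℝ, E) G).coordChange_self (achart E 1) 1 (mem_chart_source E 1) v
  refine ⟨fun h x ↦ ?_, fun h x ↦ contMDiffAt_totalSpace.2 ⟨contMDiffAt_const, ?_⟩⟩
  · exact (contMDiffAt_totalSpace.1 (h x)).2.congr_of_eventuallyEq
      (Filter.Eventually.of_forall fun y ↦ (h1 (w y)).symm)
  · exact (h x).congr_of_eventuallyEq (Filter.Eventually.of_forall fun y ↦ h1 (w y))

/-- All tangent spaces are `E` by definition, so a vector can be moved along an equality of base
points such as `y * y⁻¹ = 1`. -/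
theorem tangentBundle_mk_congr {M : Type*} [TopologicalSpace M] [ChartedSpace E M]
    [IsManifold 𝓘(ℝ, E) 1 M] {x z : M} (h : z = x) (w : E) :
    (TotalSpace.mk z w : TangentBundle 𝓘(ℝ, E) M) = TotalSpace.mk x w := by
  subst h
  rfl

theorem contMDiff_rightCoord {Y : Π x : G, TangentSpace 𝓘(ℝ, E) x}
    (hY : IsSmoothVectorField Y) : ContMDiff 𝓘(ℝ, E) 𝓘(ℝ, E) ∞ (rightCoord Y) := by
  have h1 : ContMDiff 𝓘(ℝ, E) ((𝓘(ℝ, E).prod 𝓘(ℝ, E)).prod (𝓘(ℝ, E).prod 𝓘(ℝ, E))) ∞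
      (fun y : G ↦ ((⟨y, Y y⟩, ⟨y⁻¹, 0⟩) :
        TangentBundle 𝓘(ℝ, E) G × TangentBundle 𝓘(ℝ, E) G)) :=
    ContMDiff.prodMk hY ((Bundle.contMDiff_zeroSection ℝ
      (fun x : G ↦ TangentSpace 𝓘(ℝ, E) x)).comp (contMDiff_inv 𝓘(ℝ, E) ∞))
  let w : G → E := rightCoord Y
  refine contMDiff_mk_one_iff.1 ((contMDiff_tangentMap_mul.comp h1).congr fun y ↦ ?_)
  exact (tangentBundle_mk_congr (mul_inv_cancel y) (w y)).symm.trans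
    (tangentMap_mul_zero_right y y⁻¹ (Y y)).symm

theorem isSmoothVectorField_rightField {w : G → E} (hw : ContMDiff 𝓘(ℝ, E) 𝓘(ℝ, E) ∞ w) :
    IsSmoothVectorField (rightField w) := by
  have h1 := contMDiff_tangentMap_mul.comp ((contMDiff_mk_one_iff.2 hw).prodMk
    (Bundle.contMDiff_zeroSection ℝ (fun x : G ↦ TangentSpace 𝓘(ℝ, E) x)))
  refine h1.congr fun x ↦ ?_
  exact ((tangentMap_mul_zero_right 1 x (w x)).trans
    (tangentBundle_mk_congr (E := E) (one_mul x) (rightField w x))).symm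

theorem rightCoord_rightField (w : G → E) : rightCoord (rightField w) = w :=
  funext fun x ↦ rightMaurerCartan_rightTranslation x (w x)

theorem rightField_rightCoord (Y : Π x : G, TangentSpace 𝓘(ℝ, E) x) :
    rightField (rightCoord Y) = Y :=
  funext fun x ↦ rightTranslation_rightMaurerCartan x (Y x)

theorem IsSmoothVectorField.mdifferentiableAt {M : Type*} [TopologicalSpace M] [ChartedSpace E M]
    [IsManifold 𝓘(ℝ, E) ∞ M] {Y : Π x : M, TangentSpace 𝓘(ℝ, E) x}
    (hY : IsSmoothVectorField Y) (x : M) : MDiffAt (T% Y) x :=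
  ContMDiff.mdifferentiable hY (by simp) x

/-- The derivative of a smooth vector-valued function along a smooth vector field is smooth. -/
theorem IsSmoothVectorField.contMDiff_mvfderiv {M : Type*} [TopologicalSpace M] [ChartedSpace E M]
    [IsManifold 𝓘(ℝ, E) ∞ M] {F : Type*} [NormedAddCommGroup F] [NormedSpace ℝ F] {f : M → F}
    (hf : ContMDiff 𝓘(ℝ, E) 𝓘(ℝ, F) ∞ f)
    {X : Π x : M, TangentSpace 𝓘(ℝ, E) x} (hX : IsSmoothVectorField X) :
    ContMDiff 𝓘(ℝ, E) 𝓘(ℝ, F) ∞ (fun x ↦ mvfderiv 𝓘(ℝ, E) f x (X x)) := by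
  -- The derivative along `X` is the fibre component of the tangent map of `f` composed with the
  -- section `X`.
  have h1 := (hf.contMDiff_tangentMap (m := ∞) le_rfl).comp hX
  intro x
  have h2 := ((contMDiffAt_totalSpace).1 (h1 x)).2
  refine h2.congr_of_eventuallyEq (Filter.Eventually.of_forall fun y ↦ ?_)
  simp [tangentMap, mvfderiv]
  rfl

end RightTrivialization

/-! ### Brackets of vector fields on `G`. -/

section Bracket

variable {E : Type*} [NormedAddCommGroup E] [NormedSpace ℝ E]
  {G : Type*} [TopologicalSpace G] [ChartedSpace E G] [Group G] [LieGroup 𝓘(ℝ, E) ∞ G]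

open VectorField

theorem mfderiv_apply_congr {M : Type*} [TopologicalSpace M] [ChartedSpace E M]
    {f g : M → M} (hfg : f = g) {x z : M} (h : z = x) (v : E) :
    (mfderiv 𝓘(ℝ, E) 𝓘(ℝ, E) f z v : E) = mfderiv 𝓘(ℝ, E) 𝓘(ℝ, E) g x v := by
  subst hfg h
  rfl

theorem mdifferentiableAt_inv (x : G) : MDiffAt (fun y : G ↦ y⁻¹) x :=
  (contMDiff_inv 𝓘(ℝ, E) ∞).mdifferentiable (by simp) x

theorem mdifferentiableAt_mul_const (z x : G) : MDiffAt (fun y : G ↦ y * z) x :=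
  (contMDiff_mul_right (I := 𝓘(ℝ, E)) (n := ∞)).mdifferentiable (by simp) x

theorem mdifferentiableAt_const_mul (z x : G) : MDiffAt (fun y : G ↦ z * y) x :=
  (contMDiff_mul_left (I := 𝓘(ℝ, E)) (n := ∞)).mdifferentiable (by simp) x

/-- Differentiate `y * y⁻¹ = 1` at the identity. -/
theorem mfderiv_inv_one (v : E) :
    (mfderiv 𝓘(ℝ, E) 𝓘(ℝ, E) (fun y : G ↦ y⁻¹) 1 v : E) = -v := by
  have h1 : MDiffAt (fun y : G ↦ (y, y⁻¹)) (1 : G) :=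
    mdifferentiableAt_id.prodMk (mdifferentiableAt_inv 1)
  have h2 : MDiffAt (fun p : G × G ↦ p.1 * p.2) ((1 : G), (1 : G)⁻¹) :=
    (contMDiff_mul 𝓘(ℝ, E) (G := G) ∞).mdifferentiable (by simp) _
  have h3 := mfderiv_comp_apply (1 : G) h2 h1 v
  have h4 : ((fun p : G × G ↦ p.1 * p.2) ∘ fun y : G ↦ (y, y⁻¹)) = fun _ ↦ 1 := by
    ext y; simp
  have h9 := mfderiv_prodMk (f := fun y : G ↦ y) mdifferentiableAt_id
    (mdifferentiableAt_inv (E := E) (1 : G))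
  rw [h4, mfderiv_const, h9, mfderiv_prod_eq_add_apply h2] at h3
  set w : E := mfderiv 𝓘(ℝ, E) 𝓘(ℝ, E) (fun y : G ↦ y⁻¹) 1 v with hw
  have h5 : (mfderiv 𝓘(ℝ, E) 𝓘(ℝ, E) (fun y : G ↦ y * (1 : G)⁻¹) 1 v : E) = v := by
    have : (fun y : G ↦ y * (1 : G)⁻¹) = id := by ext y; simp
    rw [this, mfderiv_id]
    rfl
  have h6 : (mfderiv 𝓘(ℝ, E) 𝓘(ℝ, E) (fun y : G ↦ 1 * y) (1 : G)⁻¹ w : E) = w := by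
    have : (fun y : G ↦ 1 * y) = id := by ext y; simp
    rw [this, mfderiv_id]
    rfl
  have h7 : (mfderiv 𝓘(ℝ, E) 𝓘(ℝ, E) (id : G → G) 1 v : E) = v := by
    rw [mfderiv_id]
    rfl
  have h8 : (0 : E) = v + w := by
    refine h3.trans ?_
    exact congrArg₂ (fun a b : E ↦ a + b) ((congrArg _ h7).trans h5) h6
  exact (neg_eq_of_add_eq_zero_right h8.symm).symm

/-- Inversion turns left translation by `x⁻¹` into right translation by `x`; the sign is its
differential at the identity. -/
theorem mpullback_inv_mulInvariantVectorField (v : GroupLieAlgebra 𝓘(ℝ, E) G) :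
    mpullback 𝓘(ℝ, E) 𝓘(ℝ, E) (fun y : G ↦ y⁻¹) (mulInvariantVectorField v)
      = rightField (E := E) (fun _ ↦ -v) := by
  ext x
  have h0 : ∀ z : G, ∀ w : E, (mfderiv 𝓘(ℝ, E) 𝓘(ℝ, E) (fun y : G ↦ y⁻¹) z⁻¹
      (mfderiv 𝓘(ℝ, E) 𝓘(ℝ, E) (fun y : G ↦ y⁻¹) z w) : E) = w := fun z w ↦ by
    refine (mfderiv_comp_apply z (mdifferentiableAt_inv z⁻¹) (mdifferentiableAt_inv z) w).symm.trans
      ?_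
    have : ((fun y : G ↦ y⁻¹) ∘ fun y : G ↦ y⁻¹) = id := by ext y; simp
    rw [this, mfderiv_id]
    rfl
  -- The pullback involves the inverse of the differential at `x`; as inversion is an involution,
  -- this is the differential at `x⁻¹`.
  have h1 : (mfderiv 𝓘(ℝ, E) 𝓘(ℝ, E) (fun y : G ↦ y⁻¹) x).inverse =
      (mfderiv 𝓘(ℝ, E) 𝓘(ℝ, E) (fun y : G ↦ y⁻¹) x⁻¹ : E →L[ℝ] E) := by
    refine ContinuousLinearMap.inverse_eq ?_ ?_
    · ext w
      have := h0 x⁻¹ w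
      refine Eq.trans ?_ this
      exact mfderiv_apply_congr rfl (inv_inv x).symm _
    · ext w
      exact h0 x w
  rw [mpullback_apply, h1]
  refine (mfderiv_comp_apply_of_eq (1 : G) (mdifferentiableAt_inv x⁻¹)
    (mdifferentiableAt_const_mul x⁻¹ 1) (mul_one _) v).symm.trans ?_
  have h2 : ((fun y : G ↦ y⁻¹) ∘ fun y : G ↦ x⁻¹ * y)
      = (fun y : G ↦ y * x) ∘ fun y : G ↦ y⁻¹ := by
    ext y; simp
  rw [h2]
  refine (mfderiv_comp_apply_of_eq (1 : G) (mdifferentiableAt_mul_const x 1)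
    (mdifferentiableAt_inv 1) inv_one v).trans ?_
  exact congrArg (mfderiv 𝓘(ℝ, E) 𝓘(ℝ, E) (fun y : G ↦ y * x) 1)
    (mfderiv_inv_one (E := E) (G := G) v)

/-- Pull back the left invariant fields of `-u` and `-v` by inversion: the two signs cancel inside
the bracket, and pulling back the bracket itself produces the remaining one. -/
theorem mlieBracket_rightField [CompleteSpace E] (u v : GroupLieAlgebra 𝓘(ℝ, E) G) :
    mlieBracket 𝓘(ℝ, E) (rightField (E := E) (fun _ : G ↦ u)) (rightField (E := E) (fun _ ↦ v))
      = rightField (E := E) (fun _ ↦ (-⁅u, v⁆ : GroupLieAlgebra 𝓘(ℝ, E) G)) := by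
  ext x
  have h := mpullback_mlieBracket (n := ∞) (f := fun y : G ↦ y⁻¹) (x₀ := x)
    (mdifferentiableAt_mulInvariantVectorField (-u)) (mdifferentiableAt_mulInvariantVectorField (-v))
    (contMDiff_inv 𝓘(ℝ, E) ∞ x) (by
      rw [minSmoothness_of_isRCLikeNormedField]
      exact ENat.LEInfty.out)
  rw [mpullback_inv_mulInvariantVectorField, mpullback_inv_mulInvariantVectorField,
    ← mulInvariantVector_mlieBracket, mpullback_inv_mulInvariantVectorField,
    ← GroupLieAlgebra.bracket_def] at h
  simpa using h.symm

theorem IsSmoothVectorField.mlieBracket [CompleteSpace E]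
    {X Y : Π x : G, TangentSpace 𝓘(ℝ, E) x} (hX : IsSmoothVectorField X)
    (hY : IsSmoothVectorField Y) : IsSmoothVectorField (mlieBracket 𝓘(ℝ, E) X Y) :=
  have : IsManifold 𝓘(ℝ, E) (((⊤ : ℕ∞) : WithTop ℕ∞) + 1) G := inferInstanceAs (IsManifold _ ∞ G)
  ContDiff.mlieBracket_vectorField (m := ⊤) (n := ⊤) hX hY (by
    rw [minSmoothness_of_isRCLikeNormedField]
    rfl)

/-- The bracket of vector fields is the commutator of derivations. -/
theorem mvfderiv_mvfderiv_sub_real [CompleteSpace E] {f : G → ℝ}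
    (hf : ContMDiff 𝓘(ℝ, E) 𝓘(ℝ, ℝ) ∞ f)
    {X Y : Π x : G, TangentSpace 𝓘(ℝ, E) x} (hX : IsSmoothVectorField X)
    (hY : IsSmoothVectorField Y) (x : G) :
    mvfderiv 𝓘(ℝ, E) (fun y ↦ mvfderiv 𝓘(ℝ, E) f y (Y y)) x (X x)
      - mvfderiv 𝓘(ℝ, E) (fun y ↦ mvfderiv 𝓘(ℝ, E) f y (X y)) x (Y x)
      = mvfderiv 𝓘(ℝ, E) f x (mlieBracket 𝓘(ℝ, E) X Y x) := by
  by_cases hE : ∃ u : E, u ≠ 0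
  -- Compare the Jacobi identity for `X, Y, f • W` with `f` times that for `X, Y, W`, where `W` is
  -- right invariant and nonzero at `x`. The difference is `(X(Y f) - Y(X f) - [X, Y] f) • W = 0`.
  · obtain ⟨u, hu⟩ := hE
    let W : Π x : G, TangentSpace 𝓘(ℝ, E) x := rightField fun _ ↦ u
    have hW : IsSmoothVectorField W := isSmoothVectorField_rightField contMDiff_const
    have hWx : W x ≠ 0 := fun h ↦ hu <| by
      have := rightMaurerCartan_rightTranslation x u
      rw [← this]
      exact (congrArg (rightMaurerCartan x) h).trans (map_zero _)
    have hd : ∀ {Z : Π x : G, TangentSpace 𝓘(ℝ, E) x}, IsSmoothVectorField Z → ∀ y : G,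
        MDiffAt (T% Z) y := fun hZ y ↦ hZ.mdifferentiableAt y
    have hfd : ∀ y, MDiffAt f y := hf.mdifferentiable (by simp)
    have hc2 : ∀ {Z : Π x : G, TangentSpace 𝓘(ℝ, E) x}, IsSmoothVectorField Z →
        ContMDiffAt 𝓘(ℝ, E) (𝓘(ℝ, E).prod 𝓘(ℝ, E)) (minSmoothness ℝ 2) (T% Z) x := fun hZ ↦
      (hZ x).of_le (by
        rw [minSmoothness_of_isRCLikeNormedField]
        exact ENat.LEInfty.out)
    have hfW : IsSmoothVectorField (f • W) := ContMDiff.smul_section hf hW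
    have key : ∀ {A B : Π x : G, TangentSpace 𝓘(ℝ, E) x}, IsSmoothVectorField A →
        IsSmoothVectorField B →
        mlieBracket 𝓘(ℝ, E) A (mlieBracket 𝓘(ℝ, E) B (f • W)) x
          = (mvfderiv 𝓘(ℝ, E) (fun y ↦ mvfderiv 𝓘(ℝ, E) f y (B y)) x (A x) • W x
            + mvfderiv 𝓘(ℝ, E) f x (B x) • mlieBracket 𝓘(ℝ, E) A W x)
            + (mvfderiv 𝓘(ℝ, E) f x (A x) • mlieBracket 𝓘(ℝ, E) B W x
            + f x • mlieBracket 𝓘(ℝ, E) A (mlieBracket 𝓘(ℝ, E) B W) x) := fun {A B} hA hB ↦ by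
      have hBf := IsSmoothVectorField.contMDiff_mvfderiv hf hB
      have h1 : mlieBracket 𝓘(ℝ, E) B (f • W) = (fun y ↦ mvfderiv 𝓘(ℝ, E) f y (B y)) • W
          + f • mlieBracket 𝓘(ℝ, E) B W := by
        ext1 y
        exact mlieBracket_smul_right (hfd y) (hd hW y)
      have h2 : IsSmoothVectorField ((fun y ↦ mvfderiv 𝓘(ℝ, E) f y (B y)) • W) :=
        ContMDiff.smul_section hBf hW
      have h3 : IsSmoothVectorField (f • mlieBracket 𝓘(ℝ, E) B W) :=
        ContMDiff.smul_section hf (hB.mlieBracket hW)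
      rw [h1, mlieBracket_add_right (hd h2 x) (hd h3 x),
        mlieBracket_smul_right (hBf.mdifferentiable (by simp) x) (hd hW x),
        mlieBracket_smul_right (hfd x) (hd (hB.mlieBracket hW) x)]
    have j1 := leibniz_identity_mlieBracket_apply (hc2 hX) (hc2 hY) (hc2 hfW)
    have j2 := leibniz_identity_mlieBracket_apply (hc2 hX) (hc2 hY) (hc2 hW)
    rw [key hX hY, key hY hX, mlieBracket_smul_right (hfd x) (hd hW x), j2] at j1
    have j3 : (mvfderiv 𝓘(ℝ, E) (fun y ↦ mvfderiv 𝓘(ℝ, E) f y (Y y)) x (X x)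
      - mvfderiv 𝓘(ℝ, E) (fun y ↦ mvfderiv 𝓘(ℝ, E) f y (X y)) x (Y x)
      - mvfderiv 𝓘(ℝ, E) f x (mlieBracket 𝓘(ℝ, E) X Y x)) • W x = 0 := by
      rw [← sub_eq_zero.2 j1]
      module
    exact sub_eq_zero.1 ((smul_eq_zero.1 j3).resolve_right hWx)
  · push Not at hE
    have h1 : ∀ v : TangentSpace 𝓘(ℝ, E) x, v = 0 := hE
    rw [h1 (X x), h1 (Y x), h1 (mlieBracket 𝓘(ℝ, E) X Y x)]
    simp

end Bracket

/-! ### Derivatives of linear and bilinear expressions. -/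

section Derivatives

variable {E : Type*} [NormedAddCommGroup E] [NormedSpace ℝ E]
  {M : Type*} [TopologicalSpace M] [ChartedSpace E M]
  {F F₁ F₂ : Type*} [NormedAddCommGroup F] [NormedSpace ℝ F]
  [NormedAddCommGroup F₁] [NormedSpace ℝ F₁] [NormedAddCommGroup F₂] [NormedSpace ℝ F₂]

theorem mvfderiv_clm_comp (L : F₁ →L[ℝ] F) {f : M → F₁} {x : M} (hf : MDiffAt f x)
    (v : TangentSpace 𝓘(ℝ, E) x) :
    mvfderiv 𝓘(ℝ, E) (fun y ↦ L (f y)) x v = L (mvfderiv 𝓘(ℝ, E) f x v) := by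
  have h := (L.hasMFDerivAt (x := f x)).comp x hf.hasMFDerivAt
  exact congrArg (fun T ↦ (T v : F)) h.mfderiv

theorem mvfderiv_bilinear (B : F₁ →L[ℝ] F₂ →L[ℝ] F) {f : M → F₁} {g : M → F₂} {x : M}
    (hf : MDiffAt f x) (hg : MDiffAt g x) (v : TangentSpace 𝓘(ℝ, E) x) :
    mvfderiv 𝓘(ℝ, E) (fun y ↦ B (f y) (g y)) x v
      = B (mvfderiv 𝓘(ℝ, E) f x v) (g x) + B (f x) (mvfderiv 𝓘(ℝ, E) g x v) := by
  have h1 := (B.isBoundedBilinearMap.hasFDerivAt (f x, g x)).hasMFDerivAt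
  have h2 : HasMFDerivAt 𝓘(ℝ, E) 𝓘(ℝ, F₁ × F₂) (fun y ↦ (f y, g y)) x
      ((mvfderiv 𝓘(ℝ, E) f x).prod (mvfderiv 𝓘(ℝ, E) g x)) :=
    ⟨hf.hasMFDerivAt.1.prodMk hg.hasMFDerivAt.1, hf.hasMFDerivAt.2.prodMk hg.hasMFDerivAt.2⟩
  have h := HasMFDerivAt.comp x h1 h2
  refine (congrArg (fun T ↦ (T v : F)) h.mfderiv).trans ?_
  exact add_comm _ _

end Derivatives

/-! ### Flatness of the right invariant connection. -/

section Connection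

variable {E : Type*} [NormedAddCommGroup E] [NormedSpace ℝ E] [FiniteDimensional ℝ E]
  {G : Type*} [TopologicalSpace G] [ChartedSpace E G] [Group G] [LieGroup 𝓘(ℝ, E) ∞ G]

open VectorField

/-- The bracket of vector fields is the commutator of derivations. -/
theorem mvfderiv_mvfderiv_sub {F : Type*} [NormedAddCommGroup F] [NormedSpace ℝ F] {f : G → F}
    (hf : ContMDiff 𝓘(ℝ, E) 𝓘(ℝ, F) ∞ f)
    {X Y : Π x : G, TangentSpace 𝓘(ℝ, E) x} (hX : IsSmoothVectorField X)
    (hY : IsSmoothVectorField Y) (x : G) :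
    mvfderiv 𝓘(ℝ, E) (fun y ↦ mvfderiv 𝓘(ℝ, E) f y (Y y)) x (X x)
      - mvfderiv 𝓘(ℝ, E) (fun y ↦ mvfderiv 𝓘(ℝ, E) f y (X y)) x (Y x)
      = mvfderiv 𝓘(ℝ, E) f x (mlieBracket 𝓘(ℝ, E) X Y x) := by
  -- Continuous linear forms separate points, which reduces the claim to real-valued functions.
  refine (SeparatingDual.eq_iff_forall_dual_eq (R := ℝ)).2 fun L ↦ ?_
  have hfd : ∀ y, MDiffAt f y := hf.mdifferentiable (by simp)
  have h := mvfderiv_mvfderiv_sub_real (f := fun y ↦ L (f y)) (L.contMDiff.comp hf) hX hY x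
  simp only [mvfderiv_clm_comp L (hfd _)] at h
  rw [mvfderiv_clm_comp L ((IsSmoothVectorField.contMDiff_mvfderiv hf hX).mdifferentiable
    (by simp) x), mvfderiv_clm_comp L ((IsSmoothVectorField.contMDiff_mvfderiv hf hY).mdifferentiable
    (by simp) x)] at h
  rw [map_sub]
  exact h

variable {𝔤 : Type*} [LeftPreLieRing 𝔤] [LeftPreLieAlgebra ℝ 𝔤]
  (φ : 𝔤 ≃ₗ⁅ℝ⁆ GroupLieAlgebra 𝓘(ℝ, E) G)

/-- The product of `𝔤` transported to the model space of `G`. -/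
def transportedProduct : E →L[ℝ] E →L[ℝ] E :=
  let B : GroupLieAlgebra 𝓘(ℝ, E) G →ₗ[ℝ] GroupLieAlgebra 𝓘(ℝ, E) G →ₗ[ℝ]
      GroupLieAlgebra 𝓘(ℝ, E) G :=
    LinearMap.mk₂ ℝ (fun v w ↦ φ (φ.symm v * φ.symm w)) (fun _ _ _ ↦ by simp [add_mul])
      (fun _ _ _ ↦ by simp [smul_mul_assoc]) (fun _ _ _ ↦ by simp [mul_add])
      (fun _ _ _ ↦ by simp [mul_smul_comm])
  LinearMap.toContinuousBilinearMap (show E →ₗ[ℝ] E →ₗ[ℝ] E from B)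

theorem bracket_eq_transportedProduct (v w : GroupLieAlgebra 𝓘(ℝ, E) G) :
    (⁅v, w⁆ : GroupLieAlgebra 𝓘(ℝ, E) G)
      = transportedProduct φ v w - transportedProduct φ w v := by
  have h : (φ ⁅φ.symm v, φ.symm w⁆ : GroupLieAlgebra 𝓘(ℝ, E) G) = ⁅v, w⁆ := by
    rw [LieEquiv.map_lie, LieEquiv.apply_symm_apply, LieEquiv.apply_symm_apply]
  rw [← h]
  exact map_sub φ _ _

theorem transportedProduct_assoc_symm (u v w : E) :
    transportedProduct φ (transportedProduct φ u v) w
      - transportedProduct φ u (transportedProduct φ v w)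
      = transportedProduct φ (transportedProduct φ v u) w
      - transportedProduct φ v (transportedProduct φ u w) := by
  have h := LeftPreLieRing.assoc_symm' (φ.symm u) (φ.symm v) (φ.symm w)
  have h1 := congrArg φ h
  simp only [associator_apply, map_sub] at h1
  have h2 : ∀ a b c : E, transportedProduct φ (transportedProduct φ a b) c
      = (φ (φ.symm a * φ.symm b * φ.symm c) : E) := fun a b c ↦
    congrArg (fun d ↦ (φ (d * φ.symm c) : E)) (φ.symm_apply_apply _)
  have h3 : ∀ a b c : E, transportedProduct φ a (transportedProduct φ b c)
      = (φ (φ.symm a * (φ.symm b * φ.symm c)) : E) := fun a b c ↦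
    congrArg (fun d ↦ (φ (φ.symm a * d) : E)) (φ.symm_apply_apply _)
  rw [h2, h2, h3, h3]
  exact h1

theorem rightInvariantConnection_eq (X Y : Π x : G, TangentSpace 𝓘(ℝ, E) x) :
    (fun x ↦ rightInvariantConnection φ Y x (X x)) = rightField (fun x ↦
      mvfderiv 𝓘(ℝ, E) (rightCoord Y) x (X x)
        - transportedProduct φ (rightCoord X x) (rightCoord Y x)) := rfl

theorem rightCoord_rightInvariantConnection (X Y : Π x : G, TangentSpace 𝓘(ℝ, E) x) :
    rightCoord (fun x ↦ rightInvariantConnection φ Y x (X x)) = fun x ↦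
      mvfderiv 𝓘(ℝ, E) (rightCoord Y) x (X x)
        - transportedProduct φ (rightCoord X x) (rightCoord Y x) := by
  rw [rightInvariantConnection_eq, rightCoord_rightField]

theorem isSmoothVectorField_rightInvariantConnection {X Y : Π x : G, TangentSpace 𝓘(ℝ, E) x}
    (hX : IsSmoothVectorField X) (hY : IsSmoothVectorField Y) :
    IsSmoothVectorField fun x ↦ rightInvariantConnection φ Y x (X x) := by
  rw [rightInvariantConnection_eq]
  refine isSmoothVectorField_rightField (ContMDiff.sub
    (IsSmoothVectorField.contMDiff_mvfderiv (contMDiff_rightCoord hY) hX) ?_)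
  exact ((transportedProduct φ).contMDiff.comp (contMDiff_rightCoord hX)).clm_apply
    (contMDiff_rightCoord hY)

theorem rightInvariantConnection_rightField_const (u v : E) (x : G) :
    rightInvariantConnection φ (rightField fun _ ↦ v) x (rightField (fun _ ↦ u) x)
      = rightField (fun _ ↦ -transportedProduct φ u v) x := by
  refine (congrFun (rightInvariantConnection_eq φ (rightField fun _ ↦ u) (rightField fun _ ↦ v))
    x).trans ?_
  simp only [rightCoord_rightField, mvfderiv_const]
  simp [rightField]

/-- Torsion is tensorial and every tangent vector extends to a right invariant field, so it suffices
to treat `u⁻` and `v⁻`, where both sides are `-[u, v]⁻`. -/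
theorem torsion_rightInvariantConnection {X Y : Π x : G, TangentSpace 𝓘(ℝ, E) x}
    (hX : IsSmoothVectorField X) (hY : IsSmoothVectorField Y) (x : G) :
    rightInvariantConnection φ Y x (X x) - rightInvariantConnection φ X x (Y x)
      = mlieBracket 𝓘(ℝ, E) X Y x := by
  have : IsManifold 𝓘(ℝ, E) 2 G := IsManifold.of_le (n := ∞) ENat.LEInfty.out
  let D := rightInvariantConnection φ
  let U : E → Π x : G, TangentSpace 𝓘(ℝ, E) x := fun u ↦ rightField (fun _ ↦ u)
  have hU : ∀ u, MDiffAt (T% (U u)) x := fun u ↦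
    (isSmoothVectorField_rightField contMDiff_const).mdifferentiableAt x
  have h1 : ∀ u v : E, D.torsion x (U u x) (U v x) = 0 := fun u v ↦ by
    rw [D.torsion_apply (hU u) (hU v), sub_eq_zero]
    refine (congrArg₂ (fun a b ↦ a - b) (rightInvariantConnection_rightField_const φ u v x)
      (rightInvariantConnection_rightField_const φ v u x)).trans
      (Eq.trans ?_ (congrFun (mlieBracket_rightField u v) x).symm)
    rw [← rightField_sub_apply]
    refine rightField_congr ?_
    refine Eq.trans ?_ (congrArg (fun b : E ↦ -b) (bracket_eq_transportedProduct φ u v).symm)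
    abel
  have h2 := D.torsion_apply (hX.mdifferentiableAt x) (hY.mdifferentiableAt x)
  have h3 : ∀ Z : Π x : G, TangentSpace 𝓘(ℝ, E) x, U (rightCoord Z x) x = Z x := fun Z ↦
    congrFun (rightField_rightCoord Z) x
  have h4 := h1 (rightCoord X x) (rightCoord Y x)
  rw [h3, h3, h2] at h4
  exact sub_eq_zero.1 h4

/-- Vanishing torsion, read as a formula for the bracket of arbitrary smooth fields; the curvature
computation needs it. -/
theorem rightCoord_mlieBracket {X Y : Π x : G, TangentSpace 𝓘(ℝ, E) x}
    (hX : IsSmoothVectorField X) (hY : IsSmoothVectorField Y) (x : G) :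
    rightCoord (mlieBracket 𝓘(ℝ, E) X Y) x
      = (mvfderiv 𝓘(ℝ, E) (rightCoord Y) x (X x)
          - transportedProduct φ (rightCoord X x) (rightCoord Y x))
        - (mvfderiv 𝓘(ℝ, E) (rightCoord X) x (Y x)
          - transportedProduct φ (rightCoord Y x) (rightCoord X x)) := by
  rw [← funext fun y ↦ torsion_rightInvariantConnection φ hX hY y, rightCoord_sub_apply,
    rightCoord_rightInvariantConnection, rightCoord_rightInvariantConnection]

theorem curvature_rightInvariantConnection {X Y Z : Π x : G, TangentSpace 𝓘(ℝ, E) x}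
    (hX : IsSmoothVectorField X) (hY : IsSmoothVectorField Y) (hZ : IsSmoothVectorField Z) (x : G) :
    rightInvariantConnection φ (fun y ↦ rightInvariantConnection φ Z y (Y y)) x (X x)
      - rightInvariantConnection φ (fun y ↦ rightInvariantConnection φ Z y (X y)) x (Y x)
      - rightInvariantConnection φ Z x (mlieBracket 𝓘(ℝ, E) X Y x) = 0 := by
  have hd : ∀ {W : Π x : G, TangentSpace 𝓘(ℝ, E) x}, IsSmoothVectorField W →
      MDiffAt (rightCoord W) x := fun hW ↦ (contMDiff_rightCoord hW).mdifferentiable (by simp) x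
  have hP : ∀ {A B : Π x : G, TangentSpace 𝓘(ℝ, E) x}, IsSmoothVectorField A →
      IsSmoothVectorField B →
      MDiffAt (fun y ↦ transportedProduct φ (rightCoord A y) (rightCoord B y)) x := fun hA hB ↦
    (((transportedProduct φ).contMDiff.comp (contMDiff_rightCoord hA)).clm_apply
      (contMDiff_rightCoord hB)).mdifferentiable (by simp) x
  have key : ∀ {A B : Π x : G, TangentSpace 𝓘(ℝ, E) x}, IsSmoothVectorField A →
      IsSmoothVectorField B →
      rightInvariantConnection φ (fun y ↦ rightInvariantConnection φ Z y (B y)) x (A x)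
        = rightField (fun _ ↦
          mvfderiv 𝓘(ℝ, E) (fun y ↦ mvfderiv 𝓘(ℝ, E) (rightCoord Z) y (B y)) x (A x)
          - (transportedProduct φ (mvfderiv 𝓘(ℝ, E) (rightCoord B) x (A x)) (rightCoord Z x)
            + transportedProduct φ (rightCoord B x) (mvfderiv 𝓘(ℝ, E) (rightCoord Z) x (A x)))
          - transportedProduct φ (rightCoord A x) (mvfderiv 𝓘(ℝ, E) (rightCoord Z) x (B x)
            - transportedProduct φ (rightCoord B x) (rightCoord Z x))) x := fun {A B} hA hB ↦ by
    refine (congrFun (rightInvariantConnection_eq φ A _) x).trans (rightField_congr ?_)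
    simp only [rightCoord_rightInvariantConnection]
    rw [mvfderiv_fun_sub
      ((IsSmoothVectorField.contMDiff_mvfderiv (contMDiff_rightCoord hZ) hB).mdifferentiable
        (by simp) x) (hP hB hZ), sub_apply,
      mvfderiv_bilinear _ (hd hB) (hd hZ)]
  rw [key hX hY, key hY hX, ← rightField_sub_apply]
  refine (congrArg (fun a ↦ _ - a) (congrFun (rightInvariantConnection_eq φ _ Z) x)).trans ?_
  rw [← rightField_sub_apply, ← rightField_zero_apply x]
  refine rightField_congr ?_
  -- After this, all terms containing derivatives cancel, leaving minus the difference of the two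
  -- associators.
  rw [rightCoord_mlieBracket φ hX hY, ← mvfderiv_mvfderiv_sub (contMDiff_rightCoord hZ) hX hY]
  have h := transportedProduct_assoc_symm φ (rightCoord X x) (rightCoord Y x) (rightCoord Z x)
  rw [← sub_eq_zero] at h
  refine Eq.trans ?_ ((congrArg Neg.neg h).trans neg_zero)
  simp only [map_sub, sub_apply]
  abel

theorem isFlat_rightInvariantConnection : (rightInvariantConnection φ).IsFlat where
  smooth _ _ hX hY := isSmoothVectorField_rightInvariantConnection φ hX hY
  torsion_eq_zero _ _ hX hY := torsion_rightInvariantConnection φ hX hY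
  curvature_eq_zero _ _ _ hX hY hZ := curvature_rightInvariantConnection φ hX hY hZ

end Connection

/-! ### Smooth and right invariant 1-forms. -/

section OneForms

variable {E : Type*} [NormedAddCommGroup E] [NormedSpace ℝ E]

theorem OneForm.contMDiff_apply {M : Type*} [TopologicalSpace M] [ChartedSpace E M]
    [IsManifold 𝓘(ℝ, E) ∞ M] (β : OneForm E M) {Y : Π x : M, TangentSpace 𝓘(ℝ, E) x}
    (hY : IsSmoothVectorField Y) : ContMDiff 𝓘(ℝ, E) 𝓘(ℝ, ℝ) ∞ (fun x ↦ β x (Y x)) := by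
  have h := ContMDiff.clm_bundle_apply (F₁ := E) (F₂ := ℝ)
    (E₁ := fun x : M ↦ TangentSpace 𝓘(ℝ, E) x) (E₂ := Bundle.Trivial M ℝ)
    (b := fun x ↦ x) (ϕ := fun x ↦ β x) (v := Y) β.smooth hY
  exact fun x ↦ (contMDiffAt_totalSpace.1 (h x)).2

theorem continuousLinearMapAt_trivializationAt_self {M : Type*} [TopologicalSpace M]
    [ChartedSpace E M] [IsManifold 𝓘(ℝ, E) ∞ M] {x z : M} (h : z = x) (v : E) :
    (trivializationAt E (TangentSpace 𝓘(ℝ, E) : M → Type _) x).continuousLinearMapAt ℝ z v = v := by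
  subst h
  rw [TangentBundle.continuousLinearMapAt_trivializationAt_eq_core (mem_chart_source E z)]
  exact (tangentBundleCore 𝓘(ℝ, E) M).coordChange_self (achart E z) z (mem_chart_source E z) v

variable {G : Type*} [TopologicalSpace G] [ChartedSpace E G] [Group G] [LieGroup 𝓘(ℝ, E) ∞ G]

/-- The right invariant 1-form with value `α` at `1`. -/
def rightInvariantForm (α : E →L[ℝ] ℝ) : OneForm E G where
  toFun := fun x ↦ α ∘L (rightMaurerCartan x : TangentSpace 𝓘(ℝ, E) x →L[ℝ] E)
  smooth := by
    intro x₀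
    refine (contMDiffAt_hom_bundle _).2 ⟨contMDiffAt_id, ?_⟩
    have h1 : ContMDiff (𝓘(ℝ, E).prod 𝓘(ℝ, E)) 𝓘(ℝ, E) ∞
        (Function.uncurry fun x y : G ↦ y * x⁻¹) :=
      contMDiff_snd.mul ((contMDiff_inv 𝓘(ℝ, E) ∞).comp contMDiff_fst)
    -- The Maurer-Cartan form is a partial derivative of the smooth map `(x, y) ↦ y * x⁻¹` along the
    -- diagonal. Its values lie over `x * x⁻¹ = x₀ * x₀⁻¹`, so the target trivialization acts as the
    -- identity.
    have h2 := ContMDiffAt.mfderiv (m := ∞) (x₀ := x₀) (fun x y : G ↦ y * x⁻¹) (fun x ↦ x)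
      (h1 _) contMDiffAt_id le_rfl
    have h3 := ((ContinuousLinearMap.compL ℝ E E ℝ α).contMDiff.contMDiffAt).comp x₀ h2
    refine h3.congr_of_eventuallyEq (Filter.Eventually.of_forall fun x ↦ ?_)
    ext v
    let w : E := rightMaurerCartan x
      ((trivializationAt E (TangentSpace 𝓘(ℝ, E) : G → Type _) x₀).symmL ℝ x v)
    have h4 : (trivializationAt ℝ (Bundle.Trivial G ℝ) x₀).continuousLinearMapAt ℝ x
        = ContinuousLinearMap.id ℝ ℝ :=
      Bundle.Trivial.continuousLinearMapAt_trivialization ℝ G ℝ x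
    refine (congrArg (fun T : ℝ →L[ℝ] ℝ ↦ T (α w)) h4).trans (congrArg α (Eq.symm ?_))
    exact continuousLinearMapAt_trivializationAt_self
      ((mul_inv_cancel x).trans (mul_inv_cancel x₀).symm) _

end OneForms

/-! ### The right invariant bivector and its covariant derivative. -/

section Bivector

variable {E : Type*} [NormedAddCommGroup E] [NormedSpace ℝ E] [FiniteDimensional ℝ E]
  {G : Type*} [TopologicalSpace G] [ChartedSpace E G] [Group G] [LieGroup 𝓘(ℝ, E) ∞ G]
  {𝔤 : Type*} [LeftPreLieRing 𝔤] [LeftPreLieAlgebra ℝ 𝔤]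
  (φ : 𝔤 ≃ₗ⁅ℝ⁆ GroupLieAlgebra 𝓘(ℝ, E) G)

/-- The linear form on `𝔤` obtained from a covector at `x` by right translation. -/
def pullCovector (x : G) (α : TangentSpace 𝓘(ℝ, E) x →L[ℝ] ℝ) : Module.Dual ℝ 𝔤 :=
  α.toLinearMap ∘ₗ (rightTranslation x).toLinearMap ∘ₗ (φ : 𝔤 →ₗ[ℝ] _)

theorem pullCovector_apply (x : G) (α : TangentSpace 𝓘(ℝ, E) x →L[ℝ] ℝ) (u : 𝔤) :
    pullCovector φ x α u = α (rightInvariantField φ u x) := rfl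

theorem rightInvariantBivector_eq_tensorForm (r : 𝔤 ⊗[ℝ] 𝔤) (x : G)
    (α β : TangentSpace 𝓘(ℝ, E) x →L[ℝ] ℝ) :
    rightInvariantBivector φ r x α β = tensorForm r (pullCovector φ x α) (pullCovector φ x β) := rfl

/-- This supplies the test forms that turn the Codazzi equation on `G` into an identity on all of
`𝔤*`. -/
theorem exists_pullCovector_rightInvariantForm (α : Module.Dual ℝ 𝔤) :
    ∃ a : OneForm E G, ∀ x, pullCovector φ x (a x) = α := by
  let L : E →L[ℝ] ℝ := LinearMap.toContinuousLinearMap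
    (show E →ₗ[ℝ] ℝ from α ∘ₗ (φ.symm : GroupLieAlgebra 𝓘(ℝ, E) G →ₗ[ℝ] 𝔤))
  refine ⟨rightInvariantForm L, fun x ↦ LinearMap.ext fun u ↦ ?_⟩
  refine (congrArg L (rightMaurerCartan_rightTranslation x (φ u))).trans ?_
  exact congrArg α (φ.symm_apply_apply u)

theorem tensorForm_zero : tensorForm (0 : 𝔤 ⊗[ℝ] 𝔤) = 0 := by
  ext; simp [tensorForm]

theorem tensorForm_add (r s : 𝔤 ⊗[ℝ] 𝔤) : tensorForm (r + s) = tensorForm r + tensorForm s := by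
  ext; simp [tensorForm]

theorem tensorForm_tmul (u v : 𝔤) (α β : Module.Dual ℝ 𝔤) :
    tensorForm (u ⊗ₜ[ℝ] v) α β = α u * β v := by
  simp [tensorForm]

theorem tensorForm_comm (r : 𝔤 ⊗[ℝ] 𝔤) (α β : Module.Dual ℝ 𝔤) :
    tensorForm (TensorProduct.comm ℝ 𝔤 𝔤 r) α β = tensorForm r β α := by
  induction r with
  | zero => simp [tensorForm_zero]
  | tmul u v => simp [tensorForm_tmul, mul_comm]
  | add r s hr hs => simp [tensorForm_add, hr, hs]

theorem isSmoothVectorField_rightInvariantField (u : 𝔤) :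
    IsSmoothVectorField (rightInvariantField φ u) :=
  isSmoothVectorField_rightField (E := E) (w := fun _ ↦ φ u) contMDiff_const

theorem isSmooth_rightInvariantBivector (r : 𝔤 ⊗[ℝ] 𝔤) :
    (rightInvariantBivector φ r).IsSmooth := by
  intro α β
  simp only [rightInvariantBivector_eq_tensorForm]
  induction r with
  | zero => simpa [tensorForm_zero] using contMDiff_const
  | tmul u v =>
    simp only [tensorForm_tmul, pullCovector_apply]
    exact (α.contMDiff_apply (isSmoothVectorField_rightInvariantField φ u)).mul
      (β.contMDiff_apply (isSmoothVectorField_rightInvariantField φ v))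
  | add r s hr hs =>
    simp only [tensorForm_add, LinearMap.add_apply]
    exact hr.add hs

/-- By linearity take `r = a ⊗ b`. The Leibniz terms of `u⁻(β(a⁻) γ(b⁻))` cancel the derivative
terms of `∇β` and `∇γ`; only `∇_{u⁻} a⁻ = -(u • a)⁻` and its analogue for `b` contribute, so the
result depends on the values at `x` alone. -/
theorem nablaBivector_rightInvariantBivector (r : 𝔤 ⊗[ℝ] 𝔤) (β γ : OneForm E G) (x : G) (u : 𝔤) :
    (rightInvariantConnection φ).nablaBivector (rightInvariantBivector φ r) β γ x
        (rightInvariantField φ u x)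
      = tensorForm r (dualLeftMul u (pullCovector φ x (β x))) (pullCovector φ x (γ x))
        + tensorForm r (pullCovector φ x (β x)) (dualLeftMul u (pullCovector φ x (γ x))) := by
  have hd : ∀ a : 𝔤, MDiffAt (T% (rightInvariantField φ a)) x := fun a ↦
    (isSmoothVectorField_rightInvariantField φ a).mdifferentiableAt x
  have hn : ∀ (δ : OneForm E G) (a : 𝔤),
      pullCovector φ x ((rightInvariantConnection φ).nablaForm δ x (rightInvariantField φ u x)) a
        = mvfderiv 𝓘(ℝ, E) (fun y ↦ δ y (rightInvariantField φ a y)) x (rightInvariantField φ u x)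
          + pullCovector φ x (δ x) (u * a) := fun δ a ↦ by
    rw [pullCovector_apply, CovariantDerivative.nablaForm_apply _ _ _ (hd a),
      rightInvariantConnection_rightInvariantField, map_neg, sub_neg_eq_add, pullCovector_apply]
  -- Stated for every tensor, so that the derivative of a sum can be split in the induction.
  have hs := fun r ↦ (isSmooth_rightInvariantBivector φ r β γ).mdifferentiable (by simp) x
  simp only [CovariantDerivative.nablaBivector, rightInvariantBivector_eq_tensorForm] at hs ⊢
  induction r with
  | zero => simp [tensorForm_zero, mvfderiv_const]
  | tmul a b =>
    simp only [tensorForm_tmul, hn, dualLeftMul]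
    simp only [pullCovector_apply]
    rw [mvfderiv_fun_mul (β.mdifferentiableAt_apply (hd a)) (γ.mdifferentiableAt_apply (hd b))]
    simp [pullCovector_apply]
    ring
  | add r s hr hs' =>
    simp only [tensorForm_add, LinearMap.add_apply]
    rw [mvfderiv_fun_add (hs r) (hs s), add_apply]
    linear_combination hr + hs'

theorem sharp_rightInvariantBivector (r : 𝔤 ⊗[ℝ] 𝔤) (x : G)
    (α : TangentSpace 𝓘(ℝ, E) x →L[ℝ] ℝ) :
    (rightInvariantBivector φ r).sharp x α
      = rightInvariantField φ (tensorSharp r (pullCovector φ x α)) x := by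
  refine (SeparatingDual.eq_iff_forall_dual_eq (R := ℝ) (V := E)).2 fun β ↦ ?_
  refine (BivectorField.apply_sharp _ x α β).trans ?_
  exact (apply_tensorSharp r (pullCovector φ x α) (pullCovector φ x β)).symm

end Bivector

/-! ### The product and bracket on the dual of `𝔤`. -/

section Algebra

variable {𝔤 : Type*} [LeftPreLieRing 𝔤] [LeftPreLieAlgebra ℝ 𝔤]

theorem dualBracket_apply (r : 𝔤 ⊗[ℝ] 𝔤) (α β : Module.Dual ℝ 𝔤) :
    dualBracket r α β = dualProduct r α β - dualProduct r β α := rfl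

theorem dualProduct_apply_apply (r : 𝔤 ⊗[ℝ] 𝔤) (α β : Module.Dual ℝ 𝔤) (u : 𝔤) :
    dualProduct r α β u = -β (tensorSharp r α * u) := rfl

/-- The S-matrix tensor measures the failure of the Codazzi equation. -/
theorem sMatrixTensor_eq (r : 𝔤 ⊗[ℝ] 𝔤) (α β γ : Module.Dual ℝ 𝔤) :
    sMatrixTensor r α β γ =
      (tensorForm r (dualLeftMul (tensorSharp r α) β) γ
        + tensorForm r β (dualLeftMul (tensorSharp r α) γ))
      - (tensorForm r (dualLeftMul (tensorSharp r β) α) γ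
        + tensorForm r α (dualLeftMul (tensorSharp r β) γ)) := by
  -- The terms of `[r_# α, r_# β]` arise from `r(β, L*_{r_# α} γ) = -⟨γ, r_# α • r_# β⟩` and its
  -- mirror image.
  rw [← apply_tensorSharp r β, ← apply_tensorSharp r α (dualLeftMul _ _), sMatrixTensor, map_sub,
    apply_tensorSharp]
  simp [dualBracket, dualLeftMul, Ring.lie_def]
  ring

theorem tensorSharp_dualBracket {r : 𝔤 ⊗[ℝ] 𝔤} (h : ∀ α β γ, sMatrixTensor r α β γ = 0)
    (α β : Module.Dual ℝ 𝔤) :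
    tensorSharp r (dualBracket r α β) = ⁅tensorSharp r α, tensorSharp r β⁆ :=
  sub_eq_zero.1 ((Module.forall_dual_apply_eq_zero_iff ℝ _).1 fun γ ↦ h α β γ)

/-- Left symmetry amounts to `[α, β]_r . γ = α.(β.γ) - β.(α.γ)`. The right side is `L*_{[r_# α, r_#
β]} γ`, because `L*` is a representation, and the hypothesis identifies this with the left side. -/
theorem isLeftSymmetricProduct_dualProduct {r : 𝔤 ⊗[ℝ] 𝔤}
    (h : ∀ α β, tensorSharp r (dualBracket r α β) = ⁅tensorSharp r α, tensorSharp r β⁆) :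
    IsLeftSymmetricProduct (dualProduct r) := by
  intro α β γ
  ext u
  have h1 := congrArg (fun a ↦ γ (a * u)) (h α β)
  have h2 := congrArg γ (LeftPreLieRing.assoc_symm' (tensorSharp r α) (tensorSharp r β) u)
  simp only [dualBracket_apply, map_sub, sub_mul, Ring.lie_def] at h1
  simp only [associator_apply, map_sub] at h2
  simp only [LinearMap.sub_apply, dualProduct_apply_apply]
  linear_combination -h1 - h2

theorem IsLeftSymmetricProduct.isLieBracket {V : Type*} [AddCommGroup V] [Module ℝ V]
    {m b : V →ₗ[ℝ] V →ₗ[ℝ] V} (hm : IsLeftSymmetricProduct m)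
    (hb : ∀ x y, b x y = m x y - m y x) : IsLieBracket b where
  self x := by simp [hb]
  jacobi x y z := by
    have h1 := sub_eq_zero.2 (hm x y z)
    have h2 := sub_eq_zero.2 (hm y z x)
    have h3 := sub_eq_zero.2 (hm z x y)
    -- The Jacobi sum of the commutator is minus this cyclic sum of associator differences.
    have h4 := congrArg₂ (· + ·) (congrArg₂ (· + ·) h1 h2) h3
    simp only [add_zero] at h4
    simp only [hb, map_sub, LinearMap.sub_apply]
    refine Eq.trans ?_ ((congrArg Neg.neg h4).trans neg_zero)
    abel

end Algebra
end

/-! ### The equivalence and its algebraic consequences. -/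

theorem mainTheorem6
    {E : Type*} [NormedAddCommGroup E] [NormedSpace ℝ E] [FiniteDimensional ℝ E]
    {G : Type*} [TopologicalSpace G] [ChartedSpace E G] [Group G] [LieGroup 𝓘(ℝ, E) ∞ G]
    {𝔤 : Type*} [LeftPreLieRing 𝔤] [LeftPreLieAlgebra ℝ 𝔤]
    (φ : 𝔤 ≃ₗ⁅ℝ⁆ GroupLieAlgebra 𝓘(ℝ, E) G)
    (r : 𝔤 ⊗[ℝ] 𝔤) (hr : TensorProduct.comm ℝ 𝔤 𝔤 r = r) :
    (IsContravariantPseudoHessian (rightInvariantConnection φ) (rightInvariantBivector φ r) ↔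
      ∀ α β γ : Module.Dual ℝ 𝔤, sMatrixTensor r α β γ = 0) ∧
    (IsContravariantPseudoHessian (rightInvariantConnection φ) (rightInvariantBivector φ r) →
      IsLeftSymmetricProduct (dualProduct r) ∧
      IsLieBracket (dualBracket r) ∧
      ∀ α β : Module.Dual ℝ 𝔤,
        tensorSharp r (dualBracket r α β) = ⁅tensorSharp r α, tensorSharp r β⁆) := by
  have codazzi_iff : ∀ (α β γ : OneForm E G) (x : G),
      (rightInvariantConnection φ).nablaBivector (rightInvariantBivector φ r) β γ x
          ((rightInvariantBivector φ r).sharp x (α x))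
        = (rightInvariantConnection φ).nablaBivector (rightInvariantBivector φ r) α γ x
          ((rightInvariantBivector φ r).sharp x (β x)) ↔
      sMatrixTensor r (pullCovector φ x (α x)) (pullCovector φ x (β x)) (pullCovector φ x (γ x))
        = 0 := fun α β γ x ↦ by
    rw [sharp_rightInvariantBivector, sharp_rightInvariantBivector,
      nablaBivector_rightInvariantBivector, nablaBivector_rightInvariantBivector,
      sMatrixTensor_eq, sub_eq_zero]
  have main : IsContravariantPseudoHessian (rightInvariantConnection φ)
      (rightInvariantBivector φ r) ↔
      ∀ α β γ : Module.Dual ℝ 𝔤, sMatrixTensor r α β γ = 0 := by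
    refine ⟨fun h α β γ ↦ ?_, fun h ↦ ⟨isFlat_rightInvariantConnection φ,
      isSmooth_rightInvariantBivector φ r, fun x α β ↦ ?_,
      fun α β γ x ↦ (codazzi_iff α β γ x).2 (h _ _ _)⟩⟩
    · obtain ⟨a, ha⟩ := exists_pullCovector_rightInvariantForm φ α
      obtain ⟨b, hb⟩ := exists_pullCovector_rightInvariantForm φ β
      obtain ⟨c, hc⟩ := exists_pullCovector_rightInvariantForm φ γ
      -- The pullbacks of `a`, `b`, `c` are the same at every point, so one point suffices.
      have := (codazzi_iff a b c 1).1 (h.codazzi a b c 1)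
      rwa [ha, hb, hc] at this
    · rw [rightInvariantBivector_eq_tensorForm, rightInvariantBivector_eq_tensorForm,
        ← tensorForm_comm, hr]
  refine ⟨main, fun h ↦ ?_⟩
  have hsharp := tensorSharp_dualBracket (main.1 h)
  have hleft := isLeftSymmetricProduct_dualProduct hsharp
  exact ⟨hleft, hleft.isLieBracket (dualBracket_apply r), hsharp⟩
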